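/- Let $N,k,T$ be positive integers with $N/k\ge 7$ and $T\ge 16k\ln(N/k)$. In the Max-reward $k$-experts problem, in each round $t=1,\dots,T$ a learner selects, possibly at random, a set $S_t\subseteq\{1,\dots,N\}$ of exactly $k$ experts, knowing only the reward vectors $r_1,\dots,r_{t-1}$ of the earlier rounds (and its own random choices); the reward vector $r_t\in[0,1]^N$ is then revealed and the learner receives the reward $\max_{i\in S_t} r_{t,i}$. The regret of the learner's policy on the reward sequence $r_1,\dots,r_T$ is $$\mathcal R_T(r)=\max_{|S|=k}\ \sum_{t=1}^T\max_{i\in S} r_{t,i}\;-\;\sum_{t=1}^T\mathbb E\Big[\max_{i\in S_t} r_{t,i}\Big],$$ where the expectation is over the random choices of the learner. Then for every (possibly randomized) online policy there is a reward sequence $r=(r_1,\dots,r_T)\in([0,1]^N)^T$ with $$\mathcal R_T(r)\ \ge\ 0.02\,\sqrt{kT\ln(N/k)}.$$ In particular the worst-case regret of every online policy is at least $0.02\sqrt{kT\ln(N/k)}$. -/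

import Mathlib

open MeasureTheory

noncomputable section

namespace KExperts

/-- A reward vector in `[0,1]^N`. -/
abbrev RewardVector (N : ℕ) : Type := Fin N → unitInterval

/-- The sets of exactly `k` experts out of `N`. -/
abbrev ExpertSet (N k : ℕ) : Type := {S : Finset (Fin N) // S.card = k}

/-- The max-reward `max_{i ∈ S} r i` of a set of experts. (`Finset.sup` takes the value `0`, the
bottom of `[0,1]`, on the empty set; all sets below have `k ≥ 1` elements.) -/
def maxReward {N : ℕ} (S : Finset (Fin N)) (r : RewardVector N) : ℝ :=
  ((S.sup r : unitInterval) : ℝ)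

/-- The reward vectors of the rounds before round `t`. -/
def past {N T : ℕ} (r : Fin T → RewardVector N) (t : Fin T) : Fin t → RewardVector N :=
  fun s => r (Fin.castLE t.isLt.le s)

/-- A randomized online policy over a horizon of `T` rounds, with source of randomness `Ω`: in
round `t` it selects a set of `k` experts, knowing the reward vectors of the rounds before `t` and
the random seed `ω`. (The sets that it selected earlier are functions of the same data, so the
choice may depend on them as well; the seed may hold fresh randomness for each round.) -/
structure OnlinePolicy (N k T : ℕ) (Ω : Type*) [MeasurableSpace Ω] where
  /-- The set of experts selected in round `t`. -/
  select (t : Fin T) (hist : Fin t → RewardVector N) (ω : Ω) : ExpertSet N k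
  /-- For every history, the selected set is a random variable. -/
  measurableSet_select (t : Fin T) (hist : Fin t → RewardVector N) (S : ExpertSet N k) :
    MeasurableSet {ω | select t hist ω = S}

/-- The largest cumulative max-reward of a fixed set of `k` experts in hindsight. -/
def bestFixedReward {N T : ℕ} (k : ℕ) (r : Fin T → RewardVector N) : ℝ :=
  ⨆ S : ExpertSet N k, ∑ t, maxReward S.1 (r t)

/-- The expected cumulative max-reward of a policy on a reward sequence, where the expectation is
over the randomness of the policy. -/
def expectedReward {N k T : ℕ} {Ω : Type*} [MeasurableSpace Ω] (P : Measure Ω)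
    (π : OnlinePolicy N k T Ω) (r : Fin T → RewardVector N) : ℝ :=
  ∑ t, ∫ ω, maxReward (π.select t (past r t) ω).1 (r t) ∂P

/-- The regret of a policy on a reward sequence. -/
def regret {N k T : ℕ} {Ω : Type*} [MeasurableSpace Ω] (P : Measure Ω)
    (π : OnlinePolicy N k T Ω) (r : Fin T → RewardVector N) : ℝ :=
  bestFixedReward k r - expectedReward P π r

end KExperts

end

/-!
The lower bound is proved with a random adversary that is defined independently of the policy: the
average regret over its reward sequences is large, so one of these sequences is bad for the policy.

Let `d = ⌊log₂ (N / k)⌋`. Choose `k` disjoint blocks of `2 ^ d` experts, the experts of each block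
being labelled by the bit vectors `x : Fin d → Bool`. In each round the adversary draws a block `j`,
a coordinate `p` and a bit `b` uniformly and independently; the experts of block `j` with `x p = b`
get reward `1` and all others get reward `0`.

* A given expert has expected reward at most `1 / (2 * k)` in each round, so by the union bound any
  `k` experts together have expected reward at most `1 / 2`. The draw of a round is independent of
  the past, so the learner cannot expect more than `T / 2`
  (`KExperts.expect_expectedReward_le`).
* In hindsight, choose one expert per block, whose `p`-th bit is the majority bit among the rounds
  in which `(j, p)` was drawn. Its choice gains `T / 2 + (∑ |Y (j, p)|) / 2`, where `Y (j, p)` is a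
  random walk with steps in `{-1, 0, 1}` that counts the excess of one bit over the other
  (`KExperts.le_bestFixedReward`).
* The variance of `Y (j, p)` is `v = T / (k * d) ≥ 1` and its fourth moment is at most `4 * v ^ 2`,
  hence `𝔼 |Y (j, p)| ≥ √v / 2` (`KExperts.half_sqrt_le_expect_abs_sum`).

The regret is thus at least `k * d * √v / 4 = √(k * d * T) / 4` on average, and `d` is at least
half of `log (N / k)`. Structuring the experts of a block by bits, instead of giving them
independent rewards, replaces a bound on the maximum of many binomial variables by a bound on the
mean absolute value of a single random walk. Expectations over the adversary are averages `𝔼` over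
the finite set of all sequences of draws.
-/

open Finset
open scoped BigOperators

namespace KExperts

/-! ### Moments of random walks -/

section RandomWalk

variable {A : Type*} [Fintype A]

lemma expect_pi_succ (n : ℕ) (f : (Fin (n + 1) → A) → ℝ) :
    𝔼 c, f c = 𝔼 c : Fin n → A, 𝔼 a, f (Fin.cons a c) := by
  rw [Finset.expect_comm, ← Finset.expect_product' univ univ, univ_product_univ]
  exact (Fintype.expect_equiv (Fin.consEquiv fun _ ↦ A) _ _ fun _ ↦ rfl).symm

variable [Nonempty A] {z : A → ℝ} {q : ℝ}

lemma expect_sum_sq (h1 : 𝔼 a, z a = 0) (h2 : 𝔼 a, z a ^ 2 = q) (n : ℕ) :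
    𝔼 c : Fin n → A, (∑ t, z (c t)) ^ 2 = n * q := by
  induction n with
  | zero => simp
  | succ n ih =>
    rw [expect_pi_succ]
    have key (y : ℝ) : 𝔼 a, (z a + y) ^ 2 = y ^ 2 + q := by
      calc 𝔼 a, (z a + y) ^ 2 = 𝔼 a, (z a ^ 2 + (2 * y) * z a + y ^ 2) := by
            congr! 2; ring
        _ = y ^ 2 + q := by
            simp only [expect_add_distrib, ← mul_expect, h1, h2, Fintype.expect_const]; ring
    simp only [Fin.sum_univ_succ, Fin.cons_zero, Fin.cons_succ, key, expect_add_distrib, ih,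
      Fintype.expect_const]
    push_cast; ring

lemma expect_sum_pow_four (h1 : 𝔼 a, z a = 0) (h2 : 𝔼 a, z a ^ 2 = q) (h3 : 𝔼 a, z a ^ 3 = 0)
    (h4 : 𝔼 a, z a ^ 4 = q) (n : ℕ) :
    𝔼 c : Fin n → A, (∑ t, z (c t)) ^ 4 = n * q + 3 * n * (n - 1) * q ^ 2 := by
  induction n with
  | zero => simp
  | succ n ih =>
    rw [expect_pi_succ]
    have key (y : ℝ) : 𝔼 a, (z a + y) ^ 4 = y ^ 4 + (6 * q) * y ^ 2 + q := by
      calc 𝔼 a, (z a + y) ^ 4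
          = 𝔼 a, (z a ^ 4 + (4 * y) * z a ^ 3 + (6 * y ^ 2) * z a ^ 2 + (4 * y ^ 3) * z a
              + y ^ 4) := by
            congr! 2; ring
        _ = y ^ 4 + (6 * q) * y ^ 2 + q := by
            simp only [expect_add_distrib, ← mul_expect, h1, h2, h3, h4, Fintype.expect_const]
            ring
    simp only [Fin.sum_univ_succ, Fin.cons_zero, Fin.cons_succ, key, expect_add_distrib, ih,
      ← mul_expect, expect_sum_sq h1 h2, Fintype.expect_const]
    push_cast; ring

/-- A random walk whose position has variance `v = n * q ≥ 1` has expected distance at least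
`√v / 2` from the origin: its fourth moment is at most `4 * v ^ 2`, which prevents it from having
most of its variance in rare large values. -/
lemma half_sqrt_le_expect_abs_sum (h1 : 𝔼 a, z a = 0) (h2 : 𝔼 a, z a ^ 2 = q)
    (h3 : 𝔼 a, z a ^ 3 = 0) (h4 : 𝔼 a, z a ^ 4 = q) (n : ℕ) (hv : 1 ≤ n * q) :
    √(n * q) / 2 ≤ 𝔼 c : Fin n → A, |∑ t, z (c t)| := by
  set v : ℝ := n * q with hv'
  set w : ℝ := √v with hw
  have hwpos : 0 < w := Real.sqrt_pos.2 (by linarith)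
  have hww : w ^ 2 = v := Real.sq_sqrt (by linarith)
  -- For `u = |y| / (2 * w)` this is `3 * u ^ 2 - u ^ 4 ≤ 2 * u`, that is,
  -- `0 ≤ u * (u - 1) ^ 2 * (u + 2)`.
  have pointwise (y : ℝ) : 3 / (4 * w) * y ^ 2 - 1 / (16 * w ^ 3) * y ^ 4 ≤ |y| := by
    have h : |y| - (3 / (4 * w) * |y| ^ 2 - 1 / (16 * w ^ 3) * |y| ^ 4)
        = |y| * (|y| - 2 * w) ^ 2 * (|y| + 4 * w) / (16 * w ^ 3) := by
      field_simp; ring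
    have h' : 0 ≤ |y| * (|y| - 2 * w) ^ 2 * (|y| + 4 * w) / (16 * w ^ 3) := by positivity
    rw [← h, sq_abs, show |y| ^ 4 = y ^ 4 from Even.pow_abs (by decide) y] at h'
    linarith
  have h4' : n * q + 3 * n * (n - 1) * q ^ 2 ≤ 4 * w ^ 4 := by
    have : w ^ 4 = v ^ 2 := by rw [← hww]; ring
    rw [this]
    have : 0 ≤ (n : ℝ) * q ^ 2 := by positivity
    nlinarith
  calc w / 2 = 3 / (4 * w) * w ^ 2 - 1 / (16 * w ^ 3) * (4 * w ^ 4) := by field_simp; norm_num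
    _ ≤ 3 / (4 * w) * w ^ 2 - 1 / (16 * w ^ 3) * (n * q + 3 * n * (n - 1) * q ^ 2) := by
      gcongr
    _ = 𝔼 c : Fin n → A, (3 / (4 * w) * (∑ t, z (c t)) ^ 2
          - 1 / (16 * w ^ 3) * (∑ t, z (c t)) ^ 4) := by
      rw [expect_sub_distrib, ← mul_expect, ← mul_expect, expect_sum_sq h1 h2,
        expect_sum_pow_four h1 h2 h3 h4, hww]
    _ ≤ 𝔼 c : Fin n → A, |∑ t, z (c t)| := expect_le_expect fun c _ ↦ pointwise _

end RandomWalk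

/-! ### Resampling one coordinate -/

lemma expect_update {ι A : Type*} [Fintype ι] [DecidableEq ι] [Fintype A] [Nonempty A] (t : ι)
    (f : (ι → A) → ℝ) : 𝔼 c, f c = 𝔼 c, 𝔼 a, f (Function.update c t a) := by
  -- Exchanging `a` with the `t`-th entry of `c` is an involution of the pairs `(c, a)`.
  have hinv : Function.Involutive
      fun x : (ι → A) × A ↦ (Function.update x.1 t x.2, x.1 t) := by
    rintro ⟨c, a⟩; simp
  rw [← expect_product' univ univ, univ_product_univ,
    Fintype.expect_equiv hinv.toPerm (fun x ↦ f (Function.update x.1 t x.2)) (fun x ↦ f x.1)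
      fun _ ↦ rfl, ← univ_product_univ, expect_product]
  simp

/-! ### The random reward vectors -/

section Adversary

variable {N k d T : ℕ}

/-- A draw `((j, p), b)` of the adversary: a block `j`, a coordinate `p` and a bit `b`. -/
abbrev Draw (k d : ℕ) : Type := (Fin k × Fin d) × Bool

/-- The contribution of a draw to the random walk of the pair `g` of a block and a coordinate: it is
`0` if another pair was drawn, and otherwise `1` or `-1` according to the bit. -/
def walkStep (g : Fin k × Fin d) (a : Draw k d) : ℝ :=
  if a.1 = g then if a.2 then 1 else -1 else 0

/-- The reward vector of a draw `((j, p), b)`. The embedding `e` places the expert with label `x`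
of block `j` among the `N` experts. The experts of block `j` whose label has `p`-th bit `b` have
reward `1`, all others, those outside of the range of `e` included, have reward `0`. -/
def drawReward (e : Fin k × (Fin d → Bool) ↪ Fin N) (a : Draw k d) : RewardVector N :=
  open Classical in fun i ↦ if ∃ x, e (a.1.1, x) = i ∧ x a.1.2 = a.2 then 1 else 0

lemma expect_walkStep (g : Fin k × Fin d) : 𝔼 a, walkStep g a = 0 := by
  rw [Fintype.expect_eq_sum_div_card, Fintype.sum_prod_type_right]
  simp [walkStep]

lemma expect_walkStep_sq (g : Fin k × Fin d) : 𝔼 a, walkStep g a ^ 2 = 1 / ((k : ℝ) * d) := by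
  rw [Fintype.expect_eq_sum_div_card, Fintype.sum_prod_type_right]
  simp [walkStep, ite_pow]
  ring

lemma walkStep_pow_three (g : Fin k × Fin d) (a : Draw k d) :
    walkStep g a ^ 3 = walkStep g a := by
  unfold walkStep; split_ifs <;> norm_num

lemma walkStep_pow_four (g : Fin k × Fin d) (a : Draw k d) :
    walkStep g a ^ 4 = walkStep g a ^ 2 := by
  unfold walkStep; split_ifs <;> norm_num

lemma half_sqrt_le_expect_abs_walk (hk : 0 < k) (hd : 0 < d) (hT : (k : ℝ) * d ≤ T)
    (g : Fin k × Fin d) :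
    √(T / (k * d)) / 2 ≤ 𝔼 c : Fin T → Draw k d, |∑ t, walkStep g (c t)| := by
  have : Nonempty (Draw k d) := ⟨g, true⟩
  have h := half_sqrt_le_expect_abs_sum (expect_walkStep g) (expect_walkStep_sq g)
    (by simp only [walkStep_pow_three, expect_walkStep])
    (by simp only [walkStep_pow_four, expect_walkStep_sq]) T
    (by rw [mul_one_div, le_div_iff₀ (by positivity)]; linarith)
  rwa [mul_one_div] at h

/-! ### The reward of the learner -/

lemma maxReward_nonneg (S : Finset (Fin N)) (r : RewardVector N) : 0 ≤ maxReward S r :=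
  (S.sup r).2.1

lemma maxReward_le_one (S : Finset (Fin N)) (r : RewardVector N) : maxReward S r ≤ 1 :=
  (S.sup r).2.2

lemma le_maxReward {S : Finset (Fin N)} {i : Fin N} (hi : i ∈ S) (r : RewardVector N) :
    (r i : ℝ) ≤ maxReward S r :=
  Subtype.coe_le_coe.2 (Finset.le_sup hi)

lemma maxReward_le_sum (S : Finset (Fin N)) (r : RewardVector N) :
    maxReward S r ≤ ∑ i ∈ S, (r i : ℝ) := by
  obtain rfl | hS := S.eq_empty_or_nonempty
  · simp [maxReward]
  · obtain ⟨i, hi, h⟩ := S.exists_mem_eq_sup hS r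
    rw [maxReward, h]
    exact single_le_sum (f := fun i ↦ (r i : ℝ)) (fun j _ ↦ (r j).2.1) hi

lemma sum_drawReward_le (e : Fin k × (Fin d → Bool) ↪ Fin N) (i : Fin N) :
    ∑ a, (drawReward e a i : ℝ) ≤ d := by
  by_cases h : ∃ y, e y = i
  · obtain ⟨⟨j, x⟩, rfl⟩ := h
    have hr (a : Draw k d) : (drawReward e a (e (j, x)) : ℝ)
        = if j = a.1.1 then if x a.1.2 = a.2 then 1 else 0 else 0 := by
      simp only [drawReward, e.injective.eq_iff, Prod.mk.injEq]
      by_cases h1 : j = a.1.1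
      · by_cases h2 : x a.1.2 = a.2
        · rw [if_pos ⟨x, ⟨h1.symm, rfl⟩, h2⟩]; simp [h1, h2]
        · rw [if_neg (by rintro ⟨y, ⟨-, rfl⟩, h⟩; exact h2 h)]; simp [h2]
      · rw [if_neg (by rintro ⟨y, ⟨h, -⟩, -⟩; exact h1 h.symm)]; simp [h1]
    simp only [hr, Fintype.sum_prod_type]
    simp
  · have hr (a : Draw k d) : drawReward e a i = 0 :=
      if_neg fun ⟨x, hx, _⟩ ↦ h ⟨_, hx⟩
    simp [hr]

/-- A single draw gives every set of `k` experts an expected reward of at most `1 / 2`, by the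
union bound: a single expert has expected reward at most `1 / (2 * k)`. -/
lemma expect_maxReward_drawReward_le (hk : 0 < k) (hd : 0 < d)
    (e : Fin k × (Fin d → Bool) ↪ Fin N) (S : ExpertSet N k) :
    𝔼 a, maxReward S.1 (drawReward e a) ≤ 1 / 2 := by
  rw [Fintype.expect_eq_sum_div_card, div_le_iff₀ (by simp; positivity)]
  calc ∑ a, maxReward S.1 (drawReward e a)
      ≤ ∑ a, ∑ i ∈ S.1, (drawReward e a i : ℝ) := sum_le_sum fun a _ ↦ maxReward_le_sum _ _
    _ = ∑ i ∈ S.1, ∑ a, (drawReward e a i : ℝ) := sum_comm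
    _ ≤ ∑ i ∈ S.1, (d : ℝ) := sum_le_sum fun i _ ↦ sum_drawReward_le e i
    _ = 1 / 2 * (Fintype.card (Draw k d) : ℝ) := by
      simp [S.2]; ring

variable {Ω : Type*} [MeasurableSpace Ω] (P : Measure Ω) [IsProbabilityMeasure P]

lemma integrable_maxReward_select (π : OnlinePolicy N k T Ω) (t : Fin T)
    (hist : Fin t → RewardVector N) (r : RewardVector N) :
    Integrable (fun ω ↦ maxReward (π.select t hist ω).1 r) P := by
  let _ : MeasurableSpace (ExpertSet N k) := ⊤
  have hm : Measurable (π.select t hist) :=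
    measurable_to_countable' fun S ↦ π.measurableSet_select t hist S
  have hm' : Measurable fun ω ↦ maxReward (π.select t hist ω).1 r :=
    (measurable_from_top (f := fun S : ExpertSet N k ↦ maxReward S.1 r)).comp hm
  refine Integrable.of_bound hm'.aestronglyMeasurable 1 (ae_of_all _ fun ω ↦ ?_)
  rw [Real.norm_of_nonneg (maxReward_nonneg _ _)]
  exact maxReward_le_one _ _

/-- The draw of round `t` is independent of the past, hence of the set selected in round `t`. -/
lemma expect_maxReward_select_le (hk : 0 < k) (hd : 0 < d)
    (e : Fin k × (Fin d → Bool) ↪ Fin N) (π : OnlinePolicy N k T Ω) (t : Fin T) (ω : Ω) :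
    𝔼 c : Fin T → Draw k d,
      maxReward (π.select t (past (fun s ↦ drawReward e (c s)) t) ω).1 (drawReward e (c t))
      ≤ 1 / 2 := by
  have : Nonempty (Draw k d) := ⟨(⟨0, hk⟩, ⟨0, hd⟩), true⟩
  rw [expect_update t]
  refine expect_le univ_nonempty fun c _ ↦ ?_
  have hpast (a : Draw k d) : past (fun s ↦ drawReward e (Function.update c t a s)) t
      = past (fun s ↦ drawReward e (c s)) t := by
    funext s
    have hs : Fin.castLE t.isLt.le s ≠ t := Fin.ne_of_lt s.isLt
    simp [past, Function.update_of_ne hs]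
  simp only [hpast, Function.update_self]
  exact expect_maxReward_drawReward_le hk hd e _

lemma expect_expectedReward_le (hk : 0 < k) (hd : 0 < d)
    (e : Fin k × (Fin d → Bool) ↪ Fin N) (π : OnlinePolicy N k T Ω) :
    𝔼 c : Fin T → Draw k d, expectedReward P π (fun t ↦ drawReward e (c t)) ≤ T / 2 := by
  have : Nonempty (Draw k d) := ⟨(⟨0, hk⟩, ⟨0, hd⟩), true⟩
  have hround (t : Fin T) : 𝔼 c : Fin T → Draw k d,
      ∫ ω, maxReward (π.select t (past (fun s ↦ drawReward e (c s)) t) ω).1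
        (drawReward e (c t)) ∂P ≤ 1 / 2 := by
    rw [Fintype.expect_eq_sum_div_card, ← integral_finsetSum _
      fun c _ ↦ integrable_maxReward_select P π t _ _, ← integral_div]
    simp only [← Fintype.expect_eq_sum_div_card]
    refine (integral_mono_of_nonneg (ae_of_all _ fun ω ↦ ?_) (integrable_const (1 / 2))
      (ae_of_all _ fun ω ↦ expect_maxReward_select_le hk hd e π t ω)).trans ?_
    · exact expect_nonneg fun c _ ↦ maxReward_nonneg _ _
    · simp
  unfold expectedReward
  rw [expect_sum_comm]
  refine (sum_le_sum fun t _ ↦ hround t).trans_eq ?_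
  simp; ring

/-! ### The reward of the best fixed set -/

/-- The comparator takes from block `j` the expert whose label records, for every coordinate `p`,
which of the two bits was drawn more often together with `(j, p)`. -/
lemma le_bestFixedReward (e : Fin k × (Fin d → Bool) ↪ Fin N) (c : Fin T → Draw k d) :
    T / 2 + (∑ g, |∑ t, walkStep g (c t)|) / 2
      ≤ bestFixedReward k (fun t ↦ drawReward e (c t)) := by
  let x (j : Fin k) (p : Fin d) : Bool := decide (0 ≤ ∑ t, walkStep (j, p) (c t))
  have hinj : Function.Injective fun j ↦ e (j, x j) := fun j j' h ↦
    (Prod.ext_iff.1 (e.injective h)).1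
  let S : ExpertSet N k := ⟨univ.map ⟨_, hinj⟩, by simp⟩
  let ε (g : Fin k × Fin d) : ℝ := if x g.1 g.2 then 1 else -1
  have habs (g : Fin k × Fin d) : |∑ t, walkStep g (c t)| = ∑ t, ε g * walkStep g (c t) := by
    rw [← mul_sum]
    by_cases h : 0 ≤ ∑ t, walkStep g (c t)
    · simp [ε, x, h, abs_of_nonneg]
    · simp [ε, x, h, abs_of_neg (not_le.1 h)]
  have hround (t : Fin T) : 1 / 2 + (∑ g, ε g * walkStep g (c t)) / 2
      ≤ maxReward S.1 (drawReward e (c t)) := by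
    have hsum : ∑ g, ε g * walkStep g (c t) = ε (c t).1 * if (c t).2 then 1 else -1 := by
      simp [walkStep]
    rw [hsum]
    by_cases h : x (c t).1.1 (c t).1.2 = (c t).2
    · have hmem : e ((c t).1.1, x (c t).1.1) ∈ S.1 := by simp [S]
      have hone : drawReward e (c t) (e ((c t).1.1, x (c t).1.1)) = 1 := if_pos ⟨_, rfl, h⟩
      have := le_maxReward hmem (drawReward e (c t))
      rw [hone] at this
      refine le_trans ?_ this
      simp only [ε, h]
      split_ifs <;> norm_num
    · refine le_trans ?_ (maxReward_nonneg _ _)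
      simp only [ε]
      cases h1 : (c t).2 <;> simp_all
      all_goals norm_num
  calc T / 2 + (∑ g, |∑ t, walkStep g (c t)|) / 2
      = ∑ t, (1 / 2 + (∑ g, ε g * walkStep g (c t)) / 2) := by
        simp only [habs]
        rw [sum_comm, sum_add_distrib, sum_div]
        simp; ring
    _ ≤ ∑ t, maxReward S.1 (drawReward e (c t)) := sum_le_sum fun t _ ↦ hround t
    _ ≤ bestFixedReward k (fun t ↦ drawReward e (c t)) :=
        le_ciSup (f := fun S : ExpertSet N k ↦ ∑ t, maxReward S.1 (drawReward e (c t)))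
          (Set.finite_range _).bddAbove S

/-! ### The regret -/

/-- The regret bound in terms of the length `d` of the labels, obtained by averaging over the draws
of all rounds. -/
lemma exists_le_regret (hk : 0 < k) (hd : 0 < d) (hN : k * 2 ^ d ≤ N) (hT : (k : ℝ) * d ≤ T)
    (π : OnlinePolicy N k T Ω) :
    ∃ r : Fin T → RewardVector N, √(k * d * T) / 4 ≤ regret P π r := by
  have : Nonempty (Draw k d) := ⟨(⟨0, hk⟩, ⟨0, hd⟩), true⟩
  obtain ⟨e⟩ : Nonempty (Fin k × (Fin d → Bool) ↪ Fin N) :=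
    Function.Embedding.nonempty_of_card_le (by simpa using hN)
  have hbest : T / 2 + √(k * d * T) / 4
      ≤ 𝔼 c : Fin T → Draw k d, bestFixedReward k (fun t ↦ drawReward e (c t)) := by
    calc (T : ℝ) / 2 + √(k * d * T) / 4
        = T / 2 + (∑ g : Fin k × Fin d, √(T / (k * d)) / 2) / 2 := by
          have hkd : (0 : ℝ) < k * d := by positivity
          have : √(k * d * T) = k * d * √(T / (k * d)) := by
            rw [show (k : ℝ) * d * T = (k * d) ^ 2 * (T / (k * d)) by field_simp,
              Real.sqrt_mul (by positivity), Real.sqrt_sq hkd.le]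
          rw [this]
          simp; ring
      _ ≤ T / 2 + (∑ g, 𝔼 c : Fin T → Draw k d, |∑ t, walkStep g (c t)|) / 2 := by
          gcongr with g
          exact half_sqrt_le_expect_abs_walk hk hd hT g
      _ = 𝔼 c : Fin T → Draw k d, (T / 2 + (∑ g, |∑ t, walkStep g (c t)|) / 2) := by
          rw [expect_add_distrib, Fintype.expect_const, ← expect_div, expect_sum_comm]
      _ ≤ _ := expect_le_expect fun c _ ↦ le_bestFixedReward e c
  obtain ⟨c, -, hc⟩ := exists_le_of_le_expect (s := univ)
    (f := fun c : Fin T → Draw k d ↦ regret P π (fun t ↦ drawReward e (c t)))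
    (a := √(k * d * T) / 4) univ_nonempty (by
      simp only [regret, expect_sub_distrib]
      linarith [expect_expectedReward_le P hk hd e π])
  exact ⟨_, hc⟩

end Adversary

end KExperts

theorem theorem4 (N k T : ℕ) (hk : 1 ≤ k) (hN : 7 ≤ (N : ℝ) / (k : ℝ))
    (hT : 16 * (k : ℝ) * Real.log ((N : ℝ) / (k : ℝ)) ≤ (T : ℝ))
    {Ω : Type*} [MeasurableSpace Ω] (P : Measure Ω) [IsProbabilityMeasure P]
    (π : KExperts.OnlinePolicy N k T Ω) :
    ∃ r : Fin T → KExperts.RewardVector N,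
      0.02 * Real.sqrt ((k : ℝ) * (T : ℝ) * Real.log ((N : ℝ) / (k : ℝ)))
        ≤ KExperts.regret P π r := by
  have hk0 : (0 : ℝ) < k := by exact_mod_cast hk
  -- The labels are as long as the number of experts per block permits.
  have h7 : 7 ≤ N / k := by
    rw [le_div_iff₀ hk0] at hN
    rw [Nat.le_div_iff_mul_le hk]
    exact_mod_cast hN
  set d := Nat.log 2 (N / k) with hd
  have hd0 : 0 < d := Nat.log_pos (by norm_num) (by omega)
  have hd1 : (1 : ℝ) ≤ d := by exact_mod_cast hd0
  have hpow : 2 ^ d ≤ N / k := Nat.pow_log_le_self 2 (by omega)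
  have hpow' : k * 2 ^ d ≤ N := (Nat.mul_le_mul_left k hpow).trans (Nat.mul_div_le N k)
  have hlt : N < k * 2 ^ (d + 1) := by
    have h := Nat.lt_pow_succ_log_self (b := 2) (by norm_num) (N / k)
    rw [Nat.div_lt_iff_lt_mul hk] at h
    rwa [mul_comm]
  set L := Real.log ((N : ℝ) / k) with hL
  have hlow : d * Real.log 2 ≤ L := by
    rw [← Real.log_pow]
    refine Real.log_le_log (by positivity) ?_
    rw [le_div_iff₀ hk0, mul_comm]
    exact_mod_cast hpow'
  have hup : L ≤ (d + 1) * Real.log 2 := by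
    have : Real.log ((2 : ℝ) ^ (d + 1)) = (d + 1) * Real.log 2 := by
      rw [Real.log_pow]; push_cast; ring
    rw [← this]
    refine Real.log_le_log (by linarith) ?_
    rw [div_le_iff₀ hk0, mul_comm]
    exact_mod_cast hlt.le
  have hlog1 := Real.log_two_gt_d9
  have hlog2 := Real.log_two_lt_d9
  have hdT : (k : ℝ) * d ≤ T := by
    refine le_trans ?_ hT
    rw [mul_right_comm, mul_comm (16 * L), mul_comm (k : ℝ) (d : ℝ), mul_comm (k : ℝ)]
    gcongr
    nlinarith
  have hL2 : L ≤ 2 * d := by nlinarith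
  obtain ⟨r, hr⟩ := KExperts.exists_le_regret P hk hd0 hpow' hdT π
  refine ⟨r, le_trans ?_ hr⟩
  calc 0.02 * √(k * T * L) ≤ 0.02 * √(12.5 ^ 2 * (k * d * T)) := by
        have h1 : (k : ℝ) * T * L ≤ k * T * (2 * d) := by gcongr
        have h2 : (0 : ℝ) ≤ k * d * T := by positivity
        have h3 : (k : ℝ) * T * L ≤ 12.5 ^ 2 * (k * d * T) := by linarith
        gcongr
    _ = √(k * d * T) / 4 := by
        rw [Real.sqrt_mul (by positivity), Real.sqrt_sq (by norm_num)]
        ring
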